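/- Let $n\ge 0$. An $n$-dimensional spherical building (not necessarily thick or irreducible) is a complete CAT(1) space $B$ together with a finite group $W$ of isometries of the unit sphere $\mathbb S^n$ (with its angular metric) generated by reflections, and a nonempty set of isometric embeddings $\iota:\mathbb S^n\to B$, called charts, which is closed under precomposition with elements of $W$, such that any two points of $B$ lie in the image of a common chart, and such that for any two charts $\iota_1,\iota_2$ the map $\iota_1^{-1}\circ\iota_2$ is, where it is defined, the restriction of an element of $W$. The images of the charts are called apartments. A subset $C\subset B$ is convex if for any $x,y\in C$ with $d(x,y)<\pi$ it contains the unique geodesic of $B$ between $x$ and $y$. It is spherical if it is isometric to a subset of the unit sphere $\mathbb S^k$ (with its angular metric) for some $k$. Let $B_1$ and $B_2$ be $n$-dimensional spherical buildings (possibly with different groups $W$), and let $f:B_1\to B_2$ be a surjective $1$-Lipschitz map. Let $C_1$ be a convex spherical subset of $B_1$ which is mapped by $f$ isometrically onto its image $C_2\subset B_2$. Let $A_2$ be an apartment in $B_2$ containing $C_2$. Then there exists an apartment $A_1$ in $B_1$ containing $C_1$ such that $f$ maps $A_1$ isometrically onto $A_2$. -/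

import Mathlib

open Set

/-- The unit sphere of dimension `n`, as the set of unit vectors of Euclidean `(n+1)`-space.
It is always used with its intrinsic (angular) distance `sphDist`, never with the chordal one. -/
abbrev Sph (n : ℕ) : Type := Metric.sphere (0 : EuclideanSpace ℝ (Fin (n + 1))) 1

/-- The intrinsic distance on the unit sphere: the angle between two unit vectors. -/
noncomputable def sphDist {n : ℕ} (u v : Sph n) : ℝ :=
  InnerProductGeometry.angle (u : EuclideanSpace ℝ (Fin (n + 1))) (v : EuclideanSpace ℝ (Fin (n + 1)))

/-- The action of a linear isometry on the unit sphere. -/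
noncomputable def sphAct {n : ℕ} (w : EuclideanSpace ℝ (Fin (n + 1)) ≃ₗᵢ[ℝ] EuclideanSpace ℝ (Fin (n + 1)))
    (u : Sph n) : Sph n :=
  ⟨w u, by simp⟩

/-- `c`, restricted to `[0, dist x y]`, is a (minimizing, unit speed) geodesic from `x` to `y`. -/
def IsGeodesicFromTo {X : Type*} [MetricSpace X] (c : ℝ → X) (x y : X) : Prop :=
  c 0 = x ∧ c (dist x y) = y ∧
    ∀ s ∈ Icc (0 : ℝ) (dist x y), ∀ t ∈ Icc (0 : ℝ) (dist x y), dist (c s) (c t) = |s - t|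

/-- `X` is a (complete) CAT(1) space: points at distance less than `π` are joined by geodesics, and
geodesic triangles `x y z` of perimeter less than `2π` are not thicker than their comparison
triangles `x' y' z'` in the unit 2-sphere. Here `p = c s` and `q = d t` are points on the two sides
issuing from the vertex `x`, and `p'`, `q'` are their comparison points. (Any two sides share a
vertex, and `x` is arbitrary.) -/
structure IsCAT1 (X : Type*) [MetricSpace X] : Prop where
  complete : CompleteSpace X
  exists_geodesic : ∀ x y : X, dist x y < Real.pi → ∃ c : ℝ → X, IsGeodesicFromTo c x y
  comparison : ∀ (x y z : X) (c d : ℝ → X),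
    dist x y + dist y z + dist z x < 2 * Real.pi →
    IsGeodesicFromTo c x y → IsGeodesicFromTo d x z →
    ∀ s ∈ Icc (0 : ℝ) (dist x y), ∀ t ∈ Icc (0 : ℝ) (dist x z),
    ∀ x' y' z' p' q' : Sph 2,
      sphDist x' y' = dist x y → sphDist y' z' = dist y z → sphDist x' z' = dist x z →
      sphDist x' p' = s → sphDist p' y' = dist x y - s →
      sphDist x' q' = t → sphDist q' z' = dist x z - t →
      dist (c s) (d t) ≤ sphDist p' q'

/-- The reflection in the hyperplane orthogonal to the vector `v`. -/
noncomputable def hyperplaneReflection {E : Type*} [NormedAddCommGroup E] [InnerProductSpace ℝ E]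
    (v : E) : E ≃ₗᵢ[ℝ] E :=
  (Submodule.orthogonal (Submodule.span ℝ {v})).reflection

/-- A finite group of isometries of the unit `n`-sphere generated by reflections, i.e. the pair
(sphere, `W`) is a spherical Coxeter complex. The group may be trivial. -/
def IsSphericalCoxeterGroup {n : ℕ}
    (W : Subgroup (EuclideanSpace ℝ (Fin (n + 1)) ≃ₗᵢ[ℝ] EuclideanSpace ℝ (Fin (n + 1)))) : Prop :=
  Finite W ∧ ∃ R : Set (EuclideanSpace ℝ (Fin (n + 1))), (∀ v ∈ R, v ≠ 0) ∧
    W = Subgroup.closure (hyperplaneReflection '' R)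

/-- An `n`-dimensional spherical building structure on the metric space `B`, in the sense of
Kleiner and Leeb: `B` is a CAT(1) space with an atlas of isometric embeddings (charts) of the unit
`n`-sphere, closed under precomposition with the Weyl group, such that any two points lie in a
common apartment and all coordinate changes are restrictions of elements of the Weyl group.
Neither thickness nor irreducibility is required. -/
structure SphericalBuilding (n : ℕ) (B : Type*) [MetricSpace B] where
  cat1 : IsCAT1 B
  weyl : Subgroup (EuclideanSpace ℝ (Fin (n + 1)) ≃ₗᵢ[ℝ] EuclideanSpace ℝ (Fin (n + 1)))
  coxeter : IsSphericalCoxeterGroup weyl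
  atlas : Set (Sph n → B)
  atlas_nonempty : atlas.Nonempty
  isometric : ∀ ι ∈ atlas, ∀ u v : Sph n, dist (ι u) (ι v) = sphDist u v
  precomp : ∀ ι ∈ atlas, ∀ w ∈ weyl, (fun u => ι (sphAct w u)) ∈ atlas
  plenty : ∀ x y : B, ∃ ι ∈ atlas, x ∈ range ι ∧ y ∈ range ι
  compatible : ∀ ι₁ ∈ atlas, ∀ ι₂ ∈ atlas, ∃ w ∈ weyl, ∀ u v : Sph n,
    ι₁ u = ι₂ v → u = sphAct w v

/-- An apartment is the image of a chart. -/
def SphericalBuilding.IsApartment {n : ℕ} {B : Type*} [MetricSpace B]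
    (𝔹 : SphericalBuilding n B) (A : Set B) : Prop :=
  ∃ ι ∈ 𝔹.atlas, range ι = A

/-- `C` is convex: it contains the geodesics between any two of its points at distance
less than `π`. -/
def IsPiConvex {B : Type*} [MetricSpace B] (C : Set B) : Prop :=
  ∀ x ∈ C, ∀ y ∈ C, dist x y < Real.pi → ∀ c : ℝ → B, IsGeodesicFromTo c x y →
    ∀ t ∈ Icc (0 : ℝ) (dist x y), c t ∈ C

/-- `C` is spherical: it is isometric to a subset of a unit sphere of some dimension. -/
def IsSphericalSet {B : Type*} [MetricSpace B] (C : Set B) : Prop :=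
  ∃ (k : ℕ) (g : C → Sph k), ∀ x y : C, sphDist (g x) (g y) = dist x y

/-- `f` maps the subset `A` isometrically onto the subset `A'`. -/
def MapsIsometricallyOnto {X Y : Type*} [MetricSpace X] [MetricSpace Y]
    (f : X → Y) (A : Set X) (A' : Set Y) : Prop :=
  (∀ x ∈ A, ∀ y ∈ A, dist (f x) (f y) = dist x y) ∧ f '' A = A'

/-!
Let `κ` parametrize an apartment of `B₂`. Since `f` is short, preimages of antipodes of `κ` are at
distance at least `π`, so they can be joined by an apartment of `B₁`. If such an apartment passes
through a preimage of a regular point `κ u`, its half great circles starting there are mapped onto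
half great circles of `κ`. Near a regular point of both buildings this makes `f` a local isometry
between two spheres, hence the restriction of a linear isometry, and some chart of `B₁` lifts `κ`
up to this reparametrization.

Given a lift `ι` of `κ` and a point `y` over `κ p`, there is a lift that takes the value `y` at `p`
and agrees with `ι` near `-p`: if `-p` is regular, any chart through `ι (-p)` and `y` will do, and
otherwise `-p` is approached as the midpoint of two nearby points, one of them regular. By
uniqueness of geodesics, the new lift agrees with `ι` wherever this is compatible with `dist`. So
the points of `C₁` can be matched one at a time. Finitely many of them suffice: the finite group
`W` divides the sphere into finitely many strata, and two charts that agree at one point of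
a stratum agree on all of it.
-/

open Filter Topology InnerProductGeometry

local notation "𝔼" n:max => EuclideanSpace ℝ (Fin (n + 1))

section Sphere

variable {n : ℕ}

theorem sphDist_self (u : Sph n) : sphDist u u = 0 :=
  angle_self (ne_zero_of_mem_unit_sphere u)

theorem sphDist_comm (u v : Sph n) : sphDist u v = sphDist v u :=
  angle_comm _ _

theorem sphDist_nonneg (u v : Sph n) : 0 ≤ sphDist u v :=
  angle_nonneg _ _

theorem sphDist_le_pi (u v : Sph n) : sphDist u v ≤ Real.pi :=
  angle_le_pi _ _

theorem sphDist_neg_right (u v : Sph n) : sphDist u (-v) = Real.pi - sphDist u v :=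
  angle_neg_right _ _

theorem sphDist_neg_neg (u v : Sph n) : sphDist (-u) (-v) = sphDist u v :=
  angle_neg_neg _ _

theorem sphDist_self_neg (u : Sph n) : sphDist u (-u) = Real.pi := by
  rw [sphDist_neg_right, sphDist_self, sub_zero]

theorem sphDist_eq_zero {u v : Sph n} : sphDist u v = 0 ↔ u = v :=
  ⟨fun h => Subtype.ext (eq_of_angle_eq_zero_of_norm_eq h (by simp)),
    fun h => h ▸ sphDist_self u⟩

theorem sphDist_eq_pi {u v : Sph n} : sphDist u v = Real.pi ↔ v = -u := by
  rw [← sphDist_eq_zero, sphDist_neg_right, sphDist_comm v u, sub_eq_zero, eq_comm]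

theorem continuous_sphDist {X : Type*} [TopologicalSpace X] {φ ψ : X → Sph n} (hφ : Continuous φ)
    (hψ : Continuous ψ) : Continuous fun x => sphDist (φ x) (ψ x) :=
  continuous_iff_continuousAt.2 fun x =>
    ContinuousAt.comp (f := fun x => ((φ x : 𝔼 n), (ψ x : 𝔼 n)))
      (continuousAt_angle (ne_zero_of_mem_unit_sphere _) (ne_zero_of_mem_unit_sphere _))
      (by fun_prop)

theorem tendsto_sphDist_self (u : Sph n) : Tendsto (fun v => sphDist v u) (𝓝 u) (𝓝 0) := by
  rw [← sphDist_self u]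
  exact (continuous_sphDist continuous_id continuous_const).tendsto u

theorem inner_eq_cos_sphDist (u v : Sph n) : inner ℝ (u : 𝔼 n) v = Real.cos (sphDist u v) :=
  inner_eq_cos_angle_of_norm_eq_one (norm_eq_of_mem_sphere u) (norm_eq_of_mem_sphere v)

theorem sphDist_sphAct (w : 𝔼 n ≃ₗᵢ[ℝ] 𝔼 n) (u v : Sph n) :
    sphDist (sphAct w u) (sphAct w v) = sphDist u v :=
  w.toLinearIsometry.angle_map _ _

theorem continuous_sphAct (w : 𝔼 n ≃ₗᵢ[ℝ] 𝔼 n) : Continuous (sphAct w) :=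
  (w.continuous.comp continuous_subtype_val).subtype_mk _

theorem sphAct_neg (w : 𝔼 n ≃ₗᵢ[ℝ] 𝔼 n) (u : Sph n) : sphAct w (-u) = -sphAct w u :=
  Subtype.ext (map_neg w (u : 𝔼 n))

theorem sphAct_sphAct_inv (w : 𝔼 n ≃ₗᵢ[ℝ] 𝔼 n) (u : Sph n) : sphAct w (sphAct w⁻¹ u) = u :=
  Subtype.ext (w.apply_symm_apply _)

theorem sphAct_surjective (w : 𝔼 n ≃ₗᵢ[ℝ] 𝔼 n) : Function.Surjective (sphAct w) :=
  fun u => ⟨sphAct w⁻¹ u, sphAct_sphAct_inv w u⟩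

open Classical in
/-- The radial projection of Euclidean space to the unit sphere. The value at `0` is arbitrary. -/
noncomputable def toSph (x : 𝔼 n) : Sph n :=
  if hx : x = 0 then ⟨EuclideanSpace.single 0 1, by simp⟩
  else ⟨NormedSpace.normalize x, by simpa using NormedSpace.norm_normalize hx⟩

theorem coe_toSph {x : 𝔼 n} (hx : x ≠ 0) : (toSph x : 𝔼 n) = NormedSpace.normalize x := by
  rw [toSph, dif_neg hx]

theorem norm_smul_toSph (x : 𝔼 n) : ‖x‖ • (toSph x : 𝔼 n) = x := by
  rcases eq_or_ne x 0 with rfl | hx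
  · rw [norm_zero, zero_smul]
  · rw [coe_toSph hx, NormedSpace.norm_smul_normalize]

theorem toSph_coe (u : Sph n) : toSph (u : 𝔼 n) = u :=
  Subtype.ext <| by
    rw [coe_toSph (ne_zero_of_mem_unit_sphere u),
      NormedSpace.normalize_eq_self_of_norm_eq_one (norm_eq_of_mem_sphere u)]

theorem toSph_smul {x : 𝔼 n} (hx : x ≠ 0) {c : ℝ} (hc : 0 < c) : toSph (c • x) = toSph x :=
  Subtype.ext <| by
    rw [coe_toSph hx, coe_toSph (smul_ne_zero hc.ne' hx), NormedSpace.normalize_smul_of_pos hc]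

theorem sphAct_toSph_eq_iff {w : 𝔼 n ≃ₗᵢ[ℝ] 𝔼 n} {x : 𝔼 n} (hx : x ≠ 0) :
    sphAct w (toSph x) = toSph x ↔ w x = x := by
  conv_rhs => rw [← norm_smul_toSph x, map_smul]
  rw [smul_right_inj (norm_ne_zero_iff.2 hx), Subtype.ext_iff]
  rfl

theorem continuousAt_toSph {x : 𝔼 n} (hx : x ≠ 0) : ContinuousAt (toSph : 𝔼 n → Sph n) x := by
  rw [Topology.IsInducing.subtypeVal.continuousAt_iff]
  have h : ContinuousAt (fun y : 𝔼 n => ‖y‖⁻¹ • y) x :=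
    (continuousAt_id.norm.inv₀ (norm_ne_zero_iff.2 hx)).smul continuousAt_id
  refine h.congr ?_
  filter_upwards [isOpen_ne.mem_nhds hx] with y hy
  exact (coe_toSph hy).symm

theorem tendsto_toSph_coe (u : Sph n) : Tendsto (toSph : 𝔼 n → Sph n) (𝓝 u) (𝓝 u) := by
  simpa only [ContinuousAt, toSph_coe] using continuousAt_toSph (ne_zero_of_mem_unit_sphere u)

theorem sphDist_toSph {x y : 𝔼 n} (hx : x ≠ 0) (hy : y ≠ 0) :
    sphDist (toSph x) (toSph y) = angle x y := by
  rw [sphDist, coe_toSph hx, coe_toSph hy, angle_normalize_left, angle_normalize_right]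

theorem sphDist_toSph_add {x y : 𝔼 n} (hx : x ≠ 0) (hy : y ≠ 0) (hxy : x + y ≠ 0) :
    sphDist (toSph x) (toSph (x + y)) + sphDist (toSph (x + y)) (toSph y) =
      sphDist (toSph x) (toSph y) := by
  rw [sphDist_toSph hx hxy, sphDist_toSph hxy hy, sphDist_toSph hx hy]
  exact (angle_eq_angle_add_add_angle_add_of_mem_span hxy <|
    Submodule.mem_span_pair.2 ⟨1, 1, by simp only [one_smul]⟩).symm

theorem add_smul_ne_zero_of_ne_neg {u v : Sph n} (huv : v ≠ -u) {t : ℝ} (ht : 0 ≤ t) :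
    (u : 𝔼 n) + t • (v : 𝔼 n) ≠ 0 := fun h => by
  have hu : t • (v : 𝔼 n) = -u := eq_neg_of_add_eq_zero_right h
  have ht1 : t = 1 := by
    simpa [norm_smul, abs_of_nonneg ht] using congrArg norm hu
  rw [ht1, one_smul] at hu
  exact huv (Subtype.ext hu)

theorem toSph_add_smul_ne_self {u v : Sph n} (huv : v ≠ u) (huv' : v ≠ -u) {t : ℝ} (ht : 0 < t) :
    toSph ((u : 𝔼 n) + t • (v : 𝔼 n)) ≠ u := fun h => by
  have hv : t • (v : 𝔼 n) = (‖(u : 𝔼 n) + t • (v : 𝔼 n)‖ - 1) • (u : 𝔼 n) := by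
    have := norm_smul_toSph ((u : 𝔼 n) + t • (v : 𝔼 n))
    rw [h] at this
    rw [sub_smul, this, one_smul, add_sub_cancel_left]
  generalize ‖(u : 𝔼 n) + t • (v : 𝔼 n)‖ - 1 = c at hv
  have hc : t = |c| := by simpa [norm_smul, abs_of_pos ht] using congrArg norm hv
  rcases abs_choice c with h' | h' <;> rw [h'] at hc
  · rw [hc] at hv ht
    exact huv (Subtype.ext (smul_right_injective _ ht.ne' hv))
  · rw [← neg_eq_iff_eq_neg.2 hc, neg_smul, ← smul_neg] at hv
    exact huv' (Subtype.ext (smul_right_injective _ ht.ne' hv))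

open Submodule in
theorem sphAct_reflection_self (q : Sph n) : sphAct (span ℝ {(q : 𝔼 n)}).reflection q = q :=
  Subtype.ext ((reflection_eq_self_iff _).2 (mem_span_singleton_self _))

open Submodule in
theorem toSph_add_sphAct_reflection {q a : Sph n} (h : 0 < inner ℝ (q : 𝔼 n) a) :
    toSph ((a : 𝔼 n) + (sphAct (span ℝ {(q : 𝔼 n)}).reflection a : 𝔼 n)) = q := by
  have hadd : (a : 𝔼 n) + (span ℝ {(q : 𝔼 n)}).reflection a =
      (2 * inner ℝ (q : 𝔼 n) a) • (q : 𝔼 n) := by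
    rw [reflection_singleton_apply, norm_eq_of_mem_sphere]
    simp [two_smul, two_mul, add_smul]
  exact (congrArg toSph hadd).trans
    ((toSph_smul (ne_zero_of_mem_unit_sphere q) (by positivity)).trans (toSph_coe q))

theorem span_eq_top_of_mem_nhds {u : Sph n} {U : Set (Sph n)} (hU : U ∈ 𝓝 u) :
    Submodule.span ℝ ((↑) '' U : Set (𝔼 n)) = ⊤ := by
  refine Submodule.eq_top_of_nonempty_interior' _ ⟨u, mem_interior_iff_mem_nhds.2 ?_⟩
  filter_upwards [tendsto_toSph_coe u hU] with x hx
  rw [← norm_smul_toSph x]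
  exact Submodule.smul_mem _ _ (Submodule.subset_span ⟨_, hx, rfl⟩)

theorem exists_sphAct_eqOn_of_mem_nhds {u : Sph n} {U : Set (Sph n)} (hU : U ∈ 𝓝 u)
    {θ : Sph n → Sph n} (h : ∀ v ∈ U, ∀ v' ∈ U, sphDist (θ v) (θ v') = sphDist v v') :
    ∃ G : 𝔼 n ≃ₗᵢ[ℝ] 𝔼 n, EqOn θ (sphAct G) U := by
  let b := Module.Basis.ofSpan (span_eq_top_of_mem_nhds hU).ge
  have hb (i) : ∃ c ∈ U, (c : 𝔼 n) = b i :=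
    Module.Basis.ofSpan_subset (span_eq_top_of_mem_nhds hU).ge ⟨i, rfl⟩
  choose c hcU hc using hb
  have hθ : ∀ v ∈ U, ∀ v' ∈ U, inner ℝ (θ v : 𝔼 n) (θ v') = inner ℝ (v : 𝔼 n) v' :=
    fun v hv v' hv' => by rw [inner_eq_cos_sphDist, inner_eq_cos_sphDist, h v hv v' hv']
  let L : 𝔼 n →ₗ[ℝ] 𝔼 n := b.constr ℝ fun i => (θ (c i) : 𝔼 n)
  have hLb (i) : L (b i) = θ (c i) := b.constr_basis ℝ _ i
  have hL : (innerₗ (𝔼 n)).compl₁₂ L L = innerₗ (𝔼 n) := by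
    refine LinearMap.ext_basis b b fun i j => ?_
    rw [LinearMap.compl₁₂_apply, innerₗ_apply_apply, innerₗ_apply_apply, hLb, hLb,
      hθ _ (hcU i) _ (hcU j), hc, hc]
  let G : 𝔼 n ≃ₗᵢ[ℝ] 𝔼 n :=
    (L.isometryOfInner fun x y => LinearMap.congr_fun₂ hL x y).toLinearIsometryEquiv rfl
  refine ⟨G, fun v hv => Subtype.ext ?_⟩
  suffices hs : G.symm (θ v) = v from (G.symm_apply_eq).1 hs
  refine InnerProductSpace.ext_inner_left_basis b fun i => ?_
  have hGb : G (b i) = θ (c i) := hLb i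
  rw [← G.inner_map_map, G.apply_symm_apply, hGb, hθ _ (hcU i) _ hv, hc]

end Sphere

section Maps

variable {n : ℕ} {B B' : Type*} [MetricSpace B] [MetricSpace B']

/-- An isometric embedding of the unit sphere with its angular metric. This is not
`Isometry φ`, as the metric of `Sph n` as a subtype is the chordal one. -/
def SphIsometric (φ : Sph n → B) : Prop :=
  ∀ u v, dist (φ u) (φ v) = sphDist u v

/-- A `1`-Lipschitz map on the unit sphere with its angular metric. -/
def SphShort (φ : Sph n → B) : Prop :=
  ∀ u v, dist (φ u) (φ v) ≤ sphDist u v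

theorem SphIsometric.injective {φ : Sph n → B} (h : SphIsometric φ) : Function.Injective φ :=
  fun u v huv => sphDist_eq_zero.1 <| by rw [← h, huv, dist_self]

theorem SphIsometric.short {φ : Sph n → B} (h : SphIsometric φ) : SphShort φ :=
  fun u v => (h u v).le

theorem SphShort.comp {φ : Sph n → B} (h : SphShort φ) {f : B → B'} (hf : LipschitzWith 1 f) :
    SphShort (f ∘ φ) :=
  fun u v => (hf.dist_le_mul (φ u) (φ v)).trans (by rw [NNReal.coe_one, one_mul]; exact h u v)

theorem SphShort.continuous {φ : Sph n → B} (h : SphShort φ) : Continuous φ :=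
  continuous_iff_continuousAt.2 fun u => tendsto_iff_dist_tendsto_zero.2 <|
    squeeze_zero (fun _ => dist_nonneg) (fun v => h v u) (tendsto_sphDist_self u)

theorem SphIsometric.isClosedEmbedding {φ : Sph n → B} (h : SphIsometric φ) :
    IsClosedEmbedding φ :=
  h.short.continuous.isClosedEmbedding h.injective

theorem SphIsometric.comp_sphAct {φ : Sph n → B} (h : SphIsometric φ) (w : 𝔼 n ≃ₗᵢ[ℝ] 𝔼 n) :
    SphIsometric (φ ∘ sphAct w) :=
  fun u v => (h _ _).trans (sphDist_sphAct w u v)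

end Maps

section CAT1

variable {n : ℕ} {X : Type*} [MetricSpace X]

theorem exists_arc_Sph_two :
    ∃ P : ℝ → Sph 2, ∀ s t, |s - t| ≤ Real.pi → sphDist (P s) (P t) = |s - t| := by
  have hnorm (t : ℝ) : ‖(!₂[Real.cos t, Real.sin t, 0] : 𝔼 2)‖ = 1 := by
    simp [EuclideanSpace.norm_eq, Fin.sum_univ_three]
  refine ⟨fun t => ⟨!₂[Real.cos t, Real.sin t, 0], mem_sphere_zero_iff_norm.2 (hnorm t)⟩,
    fun s t h => ?_⟩
  have hinner : inner ℝ (!₂[Real.cos s, Real.sin s, 0] : 𝔼 2) !₂[Real.cos t, Real.sin t, 0] =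
      Real.cos |s - t| := by
    rw [Real.cos_abs, Real.cos_sub]
    simp [PiLp.inner_apply, Fin.sum_univ_three, mul_comm]
  rw [sphDist, angle, hnorm, hnorm, hinner, mul_one, div_one, Real.arccos_cos (abs_nonneg _) h]

theorem isGeodesicFromTo_of_dist_le {c : ℝ → X} {x y : X} (hx : c 0 = x) (hy : c (dist x y) = y)
    (hc : ∀ s t, 0 ≤ s → s ≤ t → t ≤ dist x y → dist (c s) (c t) ≤ t - s) :
    IsGeodesicFromTo c x y := by
  have hlt {s t : ℝ} (hs : 0 ≤ s) (hst : s ≤ t) (ht : t ≤ dist x y) :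
      dist (c s) (c t) = t - s := by
    refine (hc s t hs hst ht).antisymm ?_
    have h₁ := hc 0 s le_rfl hs (hst.trans ht)
    have h₂ := hc t _ (hs.trans hst) ht le_rfl
    have h₃ := dist_triangle4 (c 0) (c s) (c t) (c (dist x y))
    rw [hx] at h₁ h₃
    rw [hy] at h₂ h₃
    linarith
  refine ⟨hx, hy, fun s hs t ht => ?_⟩
  rcases le_total s t with hst | hst
  · rw [hlt hs.1 hst ht.2, abs_sub_comm, abs_of_nonneg (sub_nonneg.2 hst)]
  · rw [dist_comm, hlt ht.1 hst hs.2, abs_of_nonneg (sub_nonneg.2 hst)]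

theorem IsGeodesicFromTo.dist_eq {c : ℝ → X} {x y : X} (h : IsGeodesicFromTo c x y) {s t : ℝ}
    (hs : 0 ≤ s) (hst : s ≤ t) (ht : t ≤ dist x y) : dist (c s) (c t) = t - s := by
  rw [h.2.2 s ⟨hs, hst.trans ht⟩ t ⟨hs.trans hst, ht⟩, abs_sub_comm,
    abs_of_nonneg (sub_nonneg.2 hst)]

theorem IsGeodesicFromTo.concat {c d : ℝ → X} {x y z : X} (hc : IsGeodesicFromTo c x z)
    (hd : IsGeodesicFromTo d z y) (h : dist x z + dist z y = dist x y) :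
    IsGeodesicFromTo (fun t => if t ≤ dist x z then c t else d (t - dist x z)) x y := by
  set e : ℝ → X := fun t => if t ≤ dist x z then c t else d (t - dist x z)
  have hxz : 0 ≤ dist x z := dist_nonneg
  have hzy : 0 ≤ dist z y := dist_nonneg
  have hec {t : ℝ} (ht : t ≤ dist x z) : e t = c t := if_pos ht
  have hed {t : ℝ} (ht : dist x z ≤ t) : e t = d (t - dist x z) := by
    rcases ht.eq_or_lt with rfl | ht
    · rw [hec le_rfl, hc.2.1, sub_self, hd.1]
    · exact if_neg ht.not_ge
  refine isGeodesicFromTo_of_dist_le (by rw [hec hxz, hc.1])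
    (by rw [hed (by linarith), ← h, add_sub_cancel_left, hd.2.1]) fun s t hs hst ht => ?_
  rcases le_total t (dist x z) with htz | hzt
  · rw [hec htz, hec (hst.trans htz), hc.dist_eq hs hst htz]
  rcases le_total (dist x z) s with hzs | hsz
  · rw [hed hzs, hed hzt, hd.dist_eq (by linarith) (by linarith) (by linarith)]
    linarith
  · rw [hec hsz, hed hzt]
    have h₁ := hc.dist_eq hs hsz le_rfl
    have h₂ := hd.dist_eq le_rfl (sub_nonneg.2 hzt) (by linarith)
    rw [hc.2.1] at h₁
    rw [hd.1] at h₂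
    linarith [dist_triangle (c s) z (d (t - dist x z))]

theorem IsCAT1.exists_geodesic_through (hX : IsCAT1 X) {x y z : X} (hxy : dist x y < Real.pi)
    (h : dist x z + dist z y = dist x y) :
    ∃ c : ℝ → X, IsGeodesicFromTo c x y ∧ c (dist x z) = z := by
  have hxz : 0 ≤ dist x z := dist_nonneg
  have hzy : 0 ≤ dist z y := dist_nonneg
  obtain ⟨c, hc⟩ := hX.exists_geodesic x z (by linarith)
  obtain ⟨d, hd⟩ := hX.exists_geodesic z y (by linarith)
  exact ⟨_, hc.concat hd h, (if_pos le_rfl).trans hc.2.1⟩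

theorem IsCAT1.eq_of_between (hX : IsCAT1 X) {x y z z' : X} {a b : ℝ} (hxy : dist x y < Real.pi)
    (hab : a + b ≤ dist x y) (hxz : dist x z ≤ a) (hzy : dist z y ≤ b) (hxz' : dist x z' ≤ a)
    (hzy' : dist z' y ≤ b) : z = z' := by
  have hz := dist_triangle x z y
  have hz' := dist_triangle x z' y
  obtain ⟨c, hc, hcz⟩ := hX.exists_geodesic_through (z := z) hxy (by linarith)
  obtain ⟨d, hd, hdz⟩ := hX.exists_geodesic_through (z := z') hxy (by linarith)
  rw [show dist x z = a by linarith] at hcz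
  rw [show dist x z' = a by linarith] at hdz
  have ha : 0 ≤ a := dist_nonneg.trans hxz
  have hay : a ≤ dist x y := by linarith [dist_nonneg.trans hzy]
  obtain ⟨P, hP⟩ := exists_arc_Sph_two
  have hP' {s t : ℝ} (hs : 0 ≤ s) (hst : s ≤ t) (ht : t ≤ dist x y) :
      sphDist (P s) (P t) = t - s := by
    have habs : |s - t| = t - s := by rw [abs_sub_comm, abs_of_nonneg (sub_nonneg.2 hst)]
    rw [hP s t (by linarith), habs]
  -- The triangle `x y y` is degenerate, and so is its comparison triangle.
  have hle := hX.comparison x y y c d (by rw [dist_self, dist_comm y x]; linarith) hc hd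
    a ⟨ha, hay⟩ a ⟨ha, hay⟩ (P 0) (P (dist x y)) (P (dist x y)) (P a) (P a)
    (by rw [hP' le_rfl dist_nonneg le_rfl, sub_zero]) (by rw [sphDist_self, dist_self])
    (by rw [hP' le_rfl dist_nonneg le_rfl, sub_zero])
    (by rw [hP' le_rfl ha hay, sub_zero]) (hP' ha hay le_rfl)
    (by rw [hP' le_rfl ha hay, sub_zero]) (hP' ha hay le_rfl)
  rw [sphDist_self, hcz, hdz] at hle
  exact dist_le_zero.1 hle

theorem IsCAT1.eq_of_sphDist_add (hX : IsCAT1 X) {φ ψ : Sph n → X} (hφ : SphIsometric φ)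
    (hψ : SphShort ψ) {u v w : Sph n} (huw : sphDist u w < Real.pi)
    (huvw : sphDist u v + sphDist v w = sphDist u w) (hu : φ u = ψ u)
    (hvw : dist (ψ v) (φ w) ≤ sphDist v w) : φ v = ψ v :=
  hX.eq_of_between (x := φ u) (y := φ w) (a := sphDist u v) (b := sphDist v w) (by rwa [hφ])
    (by rw [hφ, huvw]) (hφ u v).le (hφ v w).le (hu ▸ hψ u v) hvw

/-- The geodesic from `u` to its antipode through `v` is not unique in `X`, but it becomes so
once its initial piece is fixed. -/
theorem IsCAT1.eq_of_eventuallyEq (hX : IsCAT1 X) {φ ψ : Sph n → X} (hφ : SphIsometric φ)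
    (hψ : SphShort ψ) {u v : Sph n} (h : φ =ᶠ[𝓝 u] ψ)
    (hv : dist (ψ v) (φ (-u)) ≤ sphDist v (-u)) : φ v = ψ v := by
  rcases eq_or_ne v u with rfl | hvu
  · exact h.self_of_nhds
  rcases eq_or_ne v (-u) with rfl | hvu'
  · rw [sphDist_self] at hv
    exact (dist_le_zero.1 hv).symm
  have hlim : Tendsto (fun t : ℝ => toSph ((u : 𝔼 n) + t • (v : 𝔼 n))) (𝓝[>] 0) (𝓝 u) := by
    refine (tendsto_toSph_coe u).comp (tendsto_nhdsWithin_of_tendsto_nhds ?_)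
    exact (by fun_prop : Continuous fun t : ℝ => (u : 𝔼 n) + t • (v : 𝔼 n)).tendsto' 0 _
      (by rw [zero_smul, add_zero])
  obtain ⟨t, hm, ht⟩ := ((hlim.eventually h).and self_mem_nhdsWithin).exists
  have hmu := toSph_add_smul_ne_self hvu hvu' ht
  refine hX.eq_of_sphDist_add hφ hψ (u := toSph ((u : 𝔼 n) + t • (v : 𝔼 n))) (w := -u) ?_ ?_ hm hv
  · refine (sphDist_le_pi _ _).lt_of_ne fun hpi => hmu ?_
    rw [sphDist_eq_pi, neg_inj] at hpi
    exact hpi.symm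
  · have htv : (u : 𝔼 n) + t • (v : 𝔼 n) + ((-u : Sph n) : 𝔼 n) = t • (v : 𝔼 n) := by
      rw [coe_neg_sphere]
      abel
    have htv₀ : t • (v : 𝔼 n) ≠ 0 := smul_ne_zero ht.ne' (ne_zero_of_mem_unit_sphere v)
    simpa only [htv, toSph_smul (ne_zero_of_mem_unit_sphere v) ht, toSph_coe] using
      sphDist_toSph_add (add_smul_ne_zero_of_ne_neg hvu' ht.le)
        (ne_zero_of_mem_unit_sphere (-u)) (by rwa [htv])

theorem IsCAT1.eventuallyEq_toSph_add (hX : IsCAT1 X) {φ ψ : Sph n → X} (hφ : SphIsometric φ)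
    (hψ : SphShort ψ) {u v : Sph n} (huv : sphDist u v < Real.pi) (hu : φ =ᶠ[𝓝 u] ψ)
    (hv : φ v = ψ v) : φ =ᶠ[𝓝 (toSph ((u : 𝔼 n) + (v : 𝔼 n)))] ψ := by
  set m := toSph ((u : 𝔼 n) + (v : 𝔼 n))
  -- `toSph (y z)` is the point near `u` such that `z` lies between `toSph (y z)` and `v`.
  let y : Sph n → 𝔼 n := fun z => ‖(u : 𝔼 n) + (v : 𝔼 n)‖ • (z : 𝔼 n) - (v : 𝔼 n)
  have huv₀ : (u : 𝔼 n) + (v : 𝔼 n) ≠ 0 := fun h => huv.ne <| sphDist_eq_pi.2 <|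
    Subtype.ext (eq_neg_of_add_eq_zero_right h)
  have hy : Tendsto y (𝓝 m) (𝓝 u) :=
    (by fun_prop : Continuous y).tendsto' _ _ (sub_eq_of_eq_add (norm_smul_toSph _))
  have hyu := (tendsto_toSph_coe u).comp hy
  have hlt : ∀ᶠ z in 𝓝 u, sphDist z v < Real.pi :=
    (continuous_sphDist continuous_id continuous_const).continuousAt.eventually_lt_const huv
  filter_upwards [hyu.eventually hu, hyu.eventually hlt,
    hy.eventually_ne (ne_zero_of_mem_unit_sphere u)] with z hz hzv hyz
  have hyv : y z + (v : 𝔼 n) = ‖(u : 𝔼 n) + (v : 𝔼 n)‖ • (z : 𝔼 n) := sub_add_cancel _ _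
  have hz₀ := ne_zero_of_mem_unit_sphere z
  refine hX.eq_of_sphDist_add hφ hψ hzv ?_ hz (hv ▸ hψ z v)
  simpa only [hyv, toSph_smul hz₀ (norm_pos_iff.2 huv₀), toSph_coe, Function.comp_apply] using
    sphDist_toSph_add hyz (ne_zero_of_mem_unit_sphere v)
      (by rw [hyv]; exact smul_ne_zero (norm_ne_zero_iff.2 huv₀) hz₀)

end CAT1

section Regular

variable {n : ℕ} {W : Subgroup (𝔼 n ≃ₗᵢ[ℝ] 𝔼 n)}

/-- A point of the sphere is regular if its stabilizer in `W` is trivial, i.e. it lies in the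
interior of a chamber of `W`. -/
def IsRegularPoint (W : Subgroup (𝔼 n ≃ₗᵢ[ℝ] 𝔼 n)) (u : Sph n) : Prop :=
  ∀ w ∈ W, sphAct w u = u → w = 1

theorem eventually_fixes_of_displacement_le (hW : Finite W) (u : Sph n) :
    ∀ᶠ p in 𝓝 u ×ˢ 𝓝 u, ∀ w ∈ W,
      sphDist p.2 (sphAct w p.2) ≤ 2 * sphDist p.1 p.2 → sphAct w u = u := by
  rw [← nhds_prod_eq]
  have hfin : (W : Set (𝔼 n ≃ₗᵢ[ℝ] 𝔼 n)).Finite := hW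
  refine (eventually_all_finite hfin).2 fun w _ => ?_
  by_cases hw : sphAct w u = u
  · exact Eventually.of_forall fun _ _ => hw
  have hlt : 2 * sphDist u u < sphDist u (sphAct w u) := by
    rw [sphDist_self, mul_zero]
    exact (sphDist_nonneg _ _).lt_of_ne' fun h => hw (sphDist_eq_zero.1 h).symm
  have hopen : IsOpen {p : Sph n × Sph n | 2 * sphDist p.1 p.2 < sphDist p.2 (sphAct w p.2)} :=
    isOpen_lt (continuous_const.mul (continuous_sphDist continuous_fst continuous_snd))
      (continuous_sphDist continuous_snd ((continuous_sphAct w).comp continuous_snd))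
  filter_upwards [hopen.mem_nhds (x := (u, u)) hlt] with p hp hle
  exact absurd hp hle.not_gt

theorem IsRegularPoint.eventually (hW : Finite W) {u : Sph n} (hu : IsRegularPoint W u) :
    ∀ᶠ v in 𝓝 u, IsRegularPoint W v := by
  filter_upwards [(eventually_fixes_of_displacement_le hW u).diag_of_prod] with v hv w hw hwv
  exact hu w hw (hv w hw (by rw [hwv, sphDist_self, mul_zero]))

theorem interior_fixed_eq_empty {w : 𝔼 n ≃ₗᵢ[ℝ] 𝔼 n} (hw : w ≠ 1) :
    interior {x | w x = x} = ∅ := by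
  let F := LinearMap.eqLocus w.toLinearEquiv.toLinearMap LinearMap.id
  refine not_nonempty_iff_eq_empty.1 fun h => hw (LinearIsometryEquiv.ext fun x => ?_)
  have hF : F = ⊤ := F.eq_top_of_nonempty_interior' h
  exact (hF ▸ Submodule.mem_top : x ∈ F)

theorem dense_trivial_stabilizer (hW : Finite W) : Dense {x | ∀ w ∈ W, w x = x → w = 1} := by
  have hopen (w : W) : IsOpen {x | w.1 x = x → w.1 = 1} := by
    simp only [imp_iff_not_or, ofPred_or]
    exact (isOpen_ne_fun w.1.continuous continuous_id).union isOpen_const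
  have hdense (w : W) : Dense {x | w.1 x = x → w.1 = 1} := by
    by_cases hw : w.1 = 1
    · simp only [hw, implies_true, ofPred_true, dense_univ]
    · simpa only [hw, imp_false, compl_ofPred] using
        interior_eq_empty_iff_dense_compl.1 (interior_fixed_eq_empty hw)
  convert dense_iInter_of_isOpen hopen hdense using 1
  ext x
  simp only [mem_ofPred_eq, mem_iInter, Subtype.forall]

theorem frequently_isRegularPoint (hW : Finite W) (q : Sph n) :
    ∃ᶠ u in 𝓝 q, IsRegularPoint W u := by
  refine (tendsto_toSph_coe q).frequently ?_
  have hfreq := mem_closure_iff_frequently.1 (dense_trivial_stabilizer hW (q : 𝔼 n))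
  refine (hfreq.and_eventually (eventually_ne_nhds (ne_zero_of_mem_unit_sphere q))).mono ?_
  rintro x ⟨hx, hx₀⟩ w hw hwx
  exact hx w hw ((sphAct_toSph_eq_iff hx₀).1 hwx)

end Regular

namespace SphericalBuilding

variable {n : ℕ} {B : Type*} [MetricSpace B] (𝔹 : SphericalBuilding n B) {ι : Sph n → B}

theorem finite_weyl : Finite 𝔹.weyl :=
  𝔹.coxeter.1

theorem sphIsometric (hι : ι ∈ 𝔹.atlas) : SphIsometric ι :=
  𝔹.isometric ι hι

theorem exists_chart_through (hι : ι ∈ 𝔹.atlas) (u : Sph n) (y : B) :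
    ∃ ι' ∈ 𝔹.atlas, ι' u = ι u ∧ y ∈ range ι' := by
  obtain ⟨ι₁, hι₁, ⟨a, ha⟩, b, hb⟩ := 𝔹.plenty (ι u) y
  obtain ⟨w, hw, hcompat⟩ := 𝔹.compatible ι₁ hι₁ ι hι
  refine ⟨_, 𝔹.precomp ι₁ hι₁ w hw, ?_, sphAct w⁻¹ b, ?_⟩
  · rw [← hcompat a u ha, ha]
  · exact (congrArg ι₁ (sphAct_sphAct_inv w b)).trans hb

/-- Any two charts that agree at `u` agree at `v`. For instance, this is the case when `v` lies in
the closed face whose relative interior contains `u`. -/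
def Determines (u v : Sph n) : Prop :=
  ∀ ι ∈ 𝔹.atlas, ∀ ι' ∈ 𝔹.atlas, ι u = ι' u → ι v = ι' v

variable {𝔹}

theorem determines_of_displacement {u v : Sph n}
    (h : ∀ w ∈ 𝔹.weyl, sphDist v (sphAct w v) ≤ 2 * sphDist u v → sphAct w v = v) :
    𝔹.Determines u v := by
  intro ι hι ι' hι' hu
  obtain ⟨ι₁, hι₁, hv, b, hb⟩ := 𝔹.exists_chart_through hι v (ι' v)
  obtain ⟨w, hw, hcompat⟩ := 𝔹.compatible ι₁ hι₁ ι' hι'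
  have hbv := hcompat b v hb
  have hle : sphDist v (sphAct w v) ≤ 2 * sphDist u v := by
    have htri := dist_triangle_left (ι v) (ι' v) (ι u)
    rw [𝔹.sphIsometric hι, hu, 𝔹.sphIsometric hι'] at htri
    rw [← hbv, ← 𝔹.sphIsometric hι₁, hv, hb]
    linarith
  rw [← hb, hbv, h w hw hle, hv]

theorem Determines.antipode_chart {a q : Sph n} (haq : 𝔹.Determines a q) (hι : ι ∈ 𝔹.atlas) {y : B}
    (hy : Real.pi ≤ dist (ι q) y) : ∃ ι' ∈ 𝔹.atlas, ι' a = ι a ∧ ι' (-q) = y := by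
  obtain ⟨ι', hι', ha, v, rfl⟩ := 𝔹.exists_chart_through hι a y
  rw [← haq ι' hι' ι hι ha, 𝔹.sphIsometric hι'] at hy
  exact ⟨ι', hι', ha, congrArg ι' (sphDist_eq_pi.1 ((sphDist_le_pi _ _).antisymm hy)).symm⟩

theorem Determines.refl (u : Sph n) : 𝔹.Determines u u :=
  fun _ _ _ _ h => h

variable (𝔹) in
theorem eventually_determines (u : Sph n) : ∀ᶠ p in 𝓝 u ×ˢ 𝓝 u,
    (∀ w ∈ 𝔹.weyl, sphAct w u = u → sphAct w p.2 = p.2) → 𝔹.Determines p.1 p.2 := by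
  filter_upwards [eventually_fixes_of_displacement_le 𝔹.finite_weyl u] with p hp hfix
  exact determines_of_displacement fun w hw hle => hfix w hw (hp w hw hle)

variable (𝔹) in
theorem eventually_determines_center (u : Sph n) : ∀ᶠ v in 𝓝 u, 𝔹.Determines v u := by
  have hlim : Tendsto (fun v => (v, u)) (𝓝 u) (𝓝 u ×ˢ 𝓝 u) :=
    tendsto_id.prodMk tendsto_const_nhds
  exact (hlim.eventually (𝔹.eventually_determines u)).mono fun _ hv => hv fun _ _ => id

theorem eventually_determines_of_isRegularPoint {u : Sph n} (hu : IsRegularPoint 𝔹.weyl u) :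
    ∀ᶠ p in 𝓝 u ×ˢ 𝓝 u, 𝔹.Determines p.1 p.2 := by
  filter_upwards [𝔹.eventually_determines u] with p hp
  refine hp fun w hw hwu => ?_
  rw [hu w hw hwu]
  rfl

theorem eventuallyEq_of_isRegularPoint {ι' : Sph n → B} (hι : ι ∈ 𝔹.atlas) (hι' : ι' ∈ 𝔹.atlas)
    {u : Sph n} (hu : IsRegularPoint 𝔹.weyl u) (h : ι u = ι' u) : ι =ᶠ[𝓝 u] ι' := by
  have hdet := (eventually_determines_of_isRegularPoint hu).curry.self_of_nhds
  filter_upwards [hdet] with v hv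
  exact hv ι hι ι' hι' h

theorem determines_of_isPreconnected {S : Set (Sph n)} (hS : IsPreconnected S)
    (hstab : ∀ u ∈ S, ∀ v ∈ S, ∀ w ∈ 𝔹.weyl, sphAct w u = u → sphAct w v = v)
    {u v : Sph n} (hu : u ∈ S) (hv : v ∈ S) : 𝔹.Determines u v := by
  refine hS.induction₂' 𝔹.Determines (fun x hx => ?_)
    (fun x y z _ _ _ hxy hyz ι hι ι' hι' h => hyz ι hι ι' hι' (hxy ι hι ι' hι' h)) hu hv
  filter_upwards [nhdsWithin_le_nhds (𝔹.eventually_determines x).curry.self_of_nhds,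
    nhdsWithin_le_nhds (𝔹.eventually_determines_center x), self_mem_nhdsWithin] with y hxy hyx hy
  exact ⟨hxy (hstab x hx y hy), hyx⟩

end SphericalBuilding

section Lifts

variable {n : ℕ} {B₁ B₂ : Type*} [MetricSpace B₁] [MetricSpace B₂] {f : B₁ → B₂} {κ : Sph n → B₂}
  {ι : Sph n → B₁}

theorem SphIsometric.sphDist_le_dist (hκ : SphIsometric κ) (hf : LipschitzWith 1 f) {x y : B₁}
    {u v : Sph n} (hx : f x = κ u) (hy : f y = κ v) : sphDist u v ≤ dist x y := by
  simpa only [hx, hy, hκ u v, NNReal.coe_one, one_mul] using hf.dist_le_mul x y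

theorem SphIsometric.pi_le_dist (hκ : SphIsometric κ) (hf : LipschitzWith 1 f) {x y : B₁}
    {u : Sph n} (hx : f x = κ u) (hy : f y = κ (-u)) : Real.pi ≤ dist x y :=
  sphDist_self_neg u ▸ hκ.sphDist_le_dist hf hx hy

namespace SphericalBuilding

/-- The chart `ι` lifts the spherical map `κ` through `f`. -/
structure IsLift (𝔹₁ : SphericalBuilding n B₁) (f : B₁ → B₂) (κ : Sph n → B₂) (ι : Sph n → B₁) :
    Prop where
  mem_atlas : ι ∈ 𝔹₁.atlas
  map_eq : ∀ u, f (ι u) = κ u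

variable {𝔹₁ : SphericalBuilding n B₁}

theorem IsLift.of_eventuallyEq (hι : 𝔹₁.IsLift f κ ι) (hX : IsCAT1 B₂) (hf : LipschitzWith 1 f)
    (hκ : SphIsometric κ) {ι' : Sph n → B₁} (hι' : ι' ∈ 𝔹₁.atlas) {q : Sph n} (hq : ι' =ᶠ[𝓝 q] ι)
    (hneg : f (ι' (-q)) = κ (-q)) : 𝔹₁.IsLift f κ ι' := by
  have hshort := (𝔹₁.sphIsometric hι').short.comp hf
  refine ⟨hι', fun u => (hX.eq_of_eventuallyEq hκ hshort (u := q) ?_ ?_).symm⟩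
  · filter_upwards [hq] with z hz
    rw [Function.comp_apply, hz, hι.map_eq]
  · rw [← hneg]
    exact hshort u (-q)

theorem IsLift.exists_chart_eventuallyEq_of_between (hι : 𝔹₁.IsLift f κ ι) (hX : IsCAT1 B₂)
    (hf : LipschitzWith 1 f) (hκ : SphIsometric κ) {a b q : Sph n}
    (ha : IsRegularPoint 𝔹₁.weyl a) (haq : 𝔹₁.Determines a q) (hbq : 𝔹₁.Determines b q)
    (hab : sphDist a b < Real.pi) (hne : b ≠ q) (hmid : toSph ((a : 𝔼 n) + (b : 𝔼 n)) = q)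
    {y : B₁} (hy : f y = κ (-q)) : ∃ ι' ∈ 𝔹₁.atlas, ι' (-q) = y ∧ ι' =ᶠ[𝓝 q] ι := by
  have hqy := hκ.pi_le_dist hf (hι.map_eq q) hy
  obtain ⟨ιa, hιa, hιa_a, hιa_y⟩ := haq.antipode_chart hι.mem_atlas hqy
  obtain ⟨ιb, hιb, hιb_b, hιb_y⟩ := hbq.antipode_chart hι.mem_atlas hqy
  have hbetween : sphDist a q + sphDist q b = sphDist a b := by
    have hab₀ : (a : 𝔼 n) + (b : 𝔼 n) ≠ 0 := fun h => hab.ne <| sphDist_eq_pi.2 <|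
      Subtype.ext (eq_neg_of_add_eq_zero_right h)
    simpa only [hmid, toSph_coe] using sphDist_toSph_add (ne_zero_of_mem_unit_sphere a)
      (ne_zero_of_mem_unit_sphere b) hab₀
  -- `-a` lies between `b` and `-q`, whose images under `f ∘ ιb` and `κ` agree.
  have hιb_neg : f (ιb (-a)) = κ (-a) := by
    have hshort := (𝔹₁.sphIsometric hιb).short.comp hf
    refine (hX.eq_of_sphDist_add hκ hshort (u := b) (w := -q) ?_ ?_ ?_ ?_).symm
    · refine (sphDist_le_pi _ _).lt_of_ne fun hpi => hne ?_
      exact (neg_inj.1 (sphDist_eq_pi.1 hpi)).symm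
    · rw [sphDist_neg_neg, sphDist_neg_right, sphDist_neg_right, sphDist_comm b a, ← hbetween,
        sphDist_comm b q]
      ring
    · rw [Function.comp_apply, hιb_b, hι.map_eq]
    · rw [← hy, ← hιb_y]
      exact hshort _ _
  obtain ⟨ι', hι', hι'a, hι'neg⟩ :=
    (Determines.refl a).antipode_chart hι.mem_atlas (hκ.pi_le_dist hf (hι.map_eq a) hιb_neg)
  have hι'iso := 𝔹₁.sphIsometric hι'
  have hnear : ι' =ᶠ[𝓝 a] ι := eventuallyEq_of_isRegularPoint hι' hι.mem_atlas ha hι'a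
  have hnear_a : ι' =ᶠ[𝓝 a] ιa :=
    eventuallyEq_of_isRegularPoint hι' hιa ha (hι'a.trans hιa_a.symm)
  have hb : ι' b = ι b := 𝔹₁.cat1.eq_of_eventuallyEq hι'iso (𝔹₁.sphIsometric hι.mem_atlas).short
    hnear (by rw [hι'neg, ← hιb_b, 𝔹₁.sphIsometric hιb])
  have hq : ι' (-q) = y := hιa_y ▸ 𝔹₁.cat1.eq_of_eventuallyEq hι'iso (𝔹₁.sphIsometric hιa).short
    hnear_a (by rw [hι'neg, hιa_y, ← hιb_y, 𝔹₁.sphIsometric hιb])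
  refine ⟨ι', hι', hq, hmid ▸ ?_⟩
  exact 𝔹₁.cat1.eventuallyEq_toSph_add hι'iso (𝔹₁.sphIsometric hι.mem_atlas).short hab hnear hb

variable (𝔹₁) in
theorem exists_determining_pair {q : Sph n} (hq : ¬ IsRegularPoint 𝔹₁.weyl q) :
    ∃ a b, IsRegularPoint 𝔹₁.weyl a ∧ 𝔹₁.Determines a q ∧ 𝔹₁.Determines b q ∧
      sphDist a b < Real.pi ∧ b ≠ q ∧ toSph ((a : 𝔼 n) + (b : 𝔼 n)) = q := by
  set ρ := (Submodule.span ℝ {(q : 𝔼 n)}).reflection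
  have hρq : sphAct ρ q = q := sphAct_reflection_self q
  have hdet := 𝔹₁.eventually_determines_center q
  have hdet' : ∀ᶠ a in 𝓝 q, 𝔹₁.Determines (sphAct ρ a) q :=
    ((continuous_sphAct ρ).tendsto' q q hρq).eventually hdet
  have hlt : ∀ᶠ a in 𝓝 q, sphDist a (sphAct ρ a) < Real.pi :=
    (continuous_sphDist continuous_id (continuous_sphAct ρ)).continuousAt.eventually_lt_const <| by
      change sphDist q (sphAct ρ q) < Real.pi
      rw [hρq, sphDist_self]
      exact Real.pi_pos
  have hinner : ∀ᶠ a : Sph n in 𝓝 q, 0 < inner ℝ (q : 𝔼 n) (a : 𝔼 n) :=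
    (by fun_prop : Continuous fun a : Sph n => inner ℝ (q : 𝔼 n) (a : 𝔼 n)).continuousAt
      |>.eventually_const_lt (real_inner_self_pos.2 (ne_zero_of_mem_unit_sphere q))
  obtain ⟨a, ha, haq, hbq, hab, hpos⟩ :=
    ((frequently_isRegularPoint 𝔹₁.finite_weyl q).and_eventually
      (hdet.and (hdet'.and (hlt.and hinner)))).exists
  refine ⟨a, sphAct ρ a, ha, haq, hbq, hab, fun h => hq ?_, toSph_add_sphAct_reflection hpos⟩
  have haq₀ : sphDist a q = 0 := by rw [← sphDist_sphAct ρ, h, hρq, sphDist_self]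
  rwa [← sphDist_eq_zero.1 haq₀]

theorem IsLift.exists_chart_eventuallyEq (hι : 𝔹₁.IsLift f κ ι) (hX : IsCAT1 B₂)
    (hf : LipschitzWith 1 f) (hκ : SphIsometric κ) {q : Sph n} {y : B₁} (hy : f y = κ (-q)) :
    ∃ ι' ∈ 𝔹₁.atlas, ι' (-q) = y ∧ ι' =ᶠ[𝓝 q] ι := by
  by_cases hq : IsRegularPoint 𝔹₁.weyl q
  · obtain ⟨ι', hι', hιq, hιy⟩ := (Determines.refl q).antipode_chart hι.mem_atlas
      (hκ.pi_le_dist hf (hι.map_eq q) hy)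
    exact ⟨ι', hι', hιy, eventuallyEq_of_isRegularPoint hι' hι.mem_atlas hq hιq⟩
  · obtain ⟨a, b, ha, haq, hbq, hab, hne, hmid⟩ := 𝔹₁.exists_determining_pair hq
    exact hι.exists_chart_eventuallyEq_of_between hX hf hκ ha haq hbq hab hne hmid hy

theorem IsLift.exists_lift_through (hι : 𝔹₁.IsLift f κ ι) (hX : IsCAT1 B₂)
    (hf : LipschitzWith 1 f) (hκ : SphIsometric κ) {p : Sph n} {y : B₁} (hy : f y = κ p) :
    ∃ ι', 𝔹₁.IsLift f κ ι' ∧ ι' p = y ∧ ∀ z, dist (ι z) y ≤ sphDist z p → ι' z = ι z := by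
  obtain ⟨q, rfl⟩ : ∃ q, -q = p := ⟨-p, neg_neg p⟩
  obtain ⟨ι', hι', rfl, hq⟩ := hι.exists_chart_eventuallyEq hX hf hκ hy
  exact ⟨ι', hι.of_eventuallyEq hX hf hκ hι' hq hy, rfl, fun z hz =>
    𝔹₁.cat1.eq_of_eventuallyEq (𝔹₁.sphIsometric hι') (𝔹₁.sphIsometric hι.mem_atlas).short hq hz⟩

end SphericalBuilding

end Lifts

section LiftExistence

variable {n : ℕ} {B₁ B₂ : Type*} [MetricSpace B₁] [MetricSpace B₂]

namespace SphericalBuilding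

variable {𝔹₁ : SphericalBuilding n B₁} {𝔹₂ : SphericalBuilding n B₂} {f : B₁ → B₂}
  {κ : Sph n → B₂} {ι : Sph n → B₁} {θ : Sph n → Sph n}

theorem mem_range_of_isRegularPoint (hκ : κ ∈ 𝔹₂.atlas) {u : Sph n}
    (hu : IsRegularPoint 𝔹₂.weyl u) {z : B₂}
    (hz : dist (κ u) z + dist z (κ (-u)) ≤ Real.pi) : z ∈ range κ := by
  obtain ⟨κ', hκ', hκu, v, rfl⟩ := 𝔹₂.exists_chart_through hκ u z
  refine ⟨v, 𝔹₂.cat1.eq_of_eventuallyEq (𝔹₂.sphIsometric hκ) (𝔹₂.sphIsometric hκ').short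
    (eventuallyEq_of_isRegularPoint hκ hκ' hu hκu.symm) ?_⟩
  rw [← hκu, 𝔹₂.sphIsometric hκ'] at hz
  rw [sphDist_neg_right, sphDist_comm]
  linarith

theorem exists_chart_factorsThrough (hf : LipschitzWith 1 f) (hsurj : Function.Surjective f)
    (hκ : κ ∈ 𝔹₂.atlas) (hι : ι ∈ 𝔹₁.atlas) {a u : Sph n} (hu : IsRegularPoint 𝔹₂.weyl u)
    (ha : f (ι a) = κ u) :
    ∃ ι' ∈ 𝔹₁.atlas, ι' a = ι a ∧
      ∃ θ, f ∘ ι' = κ ∘ θ ∧ ∀ v, sphDist u (θ v) = sphDist a v := by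
  have hκ' := 𝔹₂.sphIsometric hκ
  obtain ⟨y, hy⟩ := hsurj (κ (-u))
  obtain ⟨ι', hι', hιa, hιy⟩ :=
    (Determines.refl a).antipode_chart hι (hκ'.pi_le_dist hf ha hy)
  have hshort := (𝔹₁.sphIsometric hι').short.comp hf
  have hle (v : Sph n) : dist (κ u) (f (ι' v)) ≤ sphDist a v := by
    rw [← ha, ← hιa]
    exact hshort a v
  have hle' (v : Sph n) : dist (f (ι' v)) (κ (-u)) ≤ Real.pi - sphDist a v := by
    rw [← hy, ← hιy, sphDist_comm, ← sphDist_neg_right]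
    exact hshort v (-a)
  have hmem (v : Sph n) : ∃ v', κ v' = f (ι' v) :=
    mem_range_of_isRegularPoint hκ hu (by linarith [hle v, hle' v])
  choose θ hθ using hmem
  refine ⟨ι', hι', hιa, θ, funext fun v => (hθ v).symm, fun v => ?_⟩
  have hv := hle v
  have hv' := hle' v
  rw [← hθ, hκ'] at hv hv'
  rw [sphDist_neg_right, sphDist_comm] at hv'
  linarith

variable (𝔹₁) in
theorem exists_chart_factorsThrough_near_isRegularPoint (hf : LipschitzWith 1 f)
    (hsurj : Function.Surjective f) (hκ : κ ∈ 𝔹₂.atlas) :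
    ∃ ι ∈ 𝔹₁.atlas, ∃ θ, f ∘ ι = κ ∘ θ ∧ ∃ u, IsRegularPoint 𝔹₁.weyl u ∧
      ∀ᶠ v in 𝓝 u, IsRegularPoint 𝔹₂.weyl (θ v) := by
  obtain ⟨u₀, hu₀⟩ := (frequently_isRegularPoint 𝔹₂.finite_weyl (toSph 0)).exists
  obtain ⟨x, hx⟩ := hsurj (κ u₀)
  obtain ⟨ι₀, hι₀, ⟨a, rfl⟩, -⟩ := 𝔹₁.plenty x x
  obtain ⟨ι, hι, -, θ, hθ, hdist⟩ := exists_chart_factorsThrough hf hsurj hκ hι₀ hu₀ hx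
  have hθa : θ a = u₀ := (sphDist_eq_zero.1 ((hdist a).trans (sphDist_self a))).symm
  have hθc : Continuous θ := by
    refine (𝔹₂.sphIsometric hκ).isClosedEmbedding.isInducing.continuous_iff.2 ?_
    rw [← hθ]
    exact ((𝔹₁.sphIsometric hι).short.comp hf).continuous
  have hreg : ∀ᶠ v in 𝓝 a, IsRegularPoint 𝔹₂.weyl (θ v) :=
    (hθc.tendsto' a u₀ hθa).eventually (hu₀.eventually 𝔹₂.finite_weyl)
  obtain ⟨u, hu, hnear⟩ :=
    ((frequently_isRegularPoint 𝔹₁.finite_weyl a).and_eventually hreg.eventually_nhds).exists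
  exact ⟨ι, hι, θ, hθ, u, hu, hnear⟩

theorem exists_nhds_sphDist_eq_of_factorsThrough (hf : LipschitzWith 1 f)
    (hsurj : Function.Surjective f) (hκ : κ ∈ 𝔹₂.atlas) (hι : ι ∈ 𝔹₁.atlas)
    (hθ : f ∘ ι = κ ∘ θ) {u : Sph n} (hu : IsRegularPoint 𝔹₁.weyl u)
    (hreg : ∀ᶠ v in 𝓝 u, IsRegularPoint 𝔹₂.weyl (θ v)) :
    ∃ V ∈ 𝓝 u, ∀ v ∈ V, ∀ v' ∈ V, sphDist (θ v) (θ v') = sphDist v v' := by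
  obtain ⟨U, hU, hdet⟩ := eventually_prod_self_iff'.1
    (eventually_determines_of_isRegularPoint (𝔹 := 𝔹₁) hu)
  refine ⟨U ∩ {v | IsRegularPoint 𝔹₂.weyl (θ v)}, inter_mem hU hreg, ?_⟩
  rintro v ⟨hvU, hv⟩ v' ⟨hvU', -⟩
  obtain ⟨ι', hι', hιv, θ', hθ', hdist⟩ :=
    exists_chart_factorsThrough hf hsurj hκ hι hv (congrFun hθ v)
  have hιv' : ι' v' = ι v' := hdet v hvU v' hvU' ι' hι' ι hι hιv
  have hθv' : θ' v' = θ v' := (𝔹₂.sphIsometric hκ).injective <|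
    (congrFun hθ' v').symm.trans ((congrArg f hιv').trans (congrFun hθ v'))
  rw [← hθv', hdist]

variable (𝔹₁) in
theorem exists_isLift_comp_sphAct (hf : LipschitzWith 1 f) (hsurj : Function.Surjective f)
    (hκ : κ ∈ 𝔹₂.atlas) : ∃ G ι, 𝔹₁.IsLift f (κ ∘ sphAct G) ι := by
  obtain ⟨ι, hι, θ, hθ, u, hu, hreg⟩ :=
    exists_chart_factorsThrough_near_isRegularPoint 𝔹₁ hf hsurj hκ
  obtain ⟨V, hV, hdist⟩ := exists_nhds_sphDist_eq_of_factorsThrough hf hsurj hκ hι hθ hu hreg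
  obtain ⟨G, hG⟩ := exists_sphAct_eqOn_of_mem_nhds hV hdist
  obtain ⟨ι', hι', hιu, θ', hθ', hdist'⟩ :=
    exists_chart_factorsThrough hf hsurj hκ hι hreg.self_of_nhds (congrFun hθ u)
  have hneg : θ' (-u) = sphAct G (-u) := by
    rw [sphAct_neg, ← hG (mem_of_mem_nhds hV)]
    exact sphDist_eq_pi.1 ((hdist' (-u)).trans (sphDist_self_neg u))
  have hshort := (𝔹₁.sphIsometric hι').short.comp hf
  refine ⟨G, ι', hι', fun v => (𝔹₂.cat1.eq_of_eventuallyEq (u := u)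
    ((𝔹₂.sphIsometric hκ).comp_sphAct G) hshort ?_ ?_).symm⟩
  · filter_upwards [hV, eventuallyEq_of_isRegularPoint hι' hι hu hιu] with z hz hιz
    rw [Function.comp_apply, Function.comp_apply, hιz, ← hG hz]
    exact (congrFun hθ z).symm
  · have hιneg : f (ι' (-u)) = (κ ∘ sphAct G) (-u) :=
      (congrFun hθ' (-u)).trans (congrArg κ hneg)
    rw [← hιneg]
    exact hshort v (-u)

end SphericalBuilding

end LiftExistence

section Strata

variable {n : ℕ} {W : Subgroup (𝔼 n ≃ₗᵢ[ℝ] 𝔼 n)}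

/-- The coordinatewise signs of the displacements of a vector under the elements of `W`. The
fibers are convex, and `W` has the same stabilizer at all points of a fiber. -/
noncomputable def displacementSign (W : Subgroup (𝔼 n ≃ₗᵢ[ℝ] 𝔼 n)) (x : 𝔼 n) :
    W → Fin (n + 1) → SignType :=
  fun w i => SignType.sign ((w.1 x - x) i)

theorem convex_displacementSign_preimage (s : W → Fin (n + 1) → SignType) :
    Convex ℝ (displacementSign W ⁻¹' {s}) := by
  have hfiber : displacementSign W ⁻¹' {s} =
      ⋂ (w : W) (i), {x | SignType.sign ((w.1 x - x) i) = s w i} := by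
    ext x
    simp only [mem_preimage, mem_singleton_iff, displacementSign, funext_iff, mem_iInter,
      mem_ofPred_eq]
  rw [hfiber]
  refine convex_iInter₂ fun w i => ?_
  have hlin : IsLinearMap ℝ fun x : 𝔼 n => (w.1 x - x) i :=
    ⟨fun x y => by simp only [map_add, PiLp.sub_apply, PiLp.add_apply]; ring,
      fun c x => by simp only [map_smul, PiLp.sub_apply, PiLp.smul_apply, smul_sub]⟩
  exact ((ordConnected_singleton (a := s w i)).preimage_mono
    SignType.sign.monotone).convex.is_linear_preimage hlin

theorem fixes_of_displacementSign_eq {x y : 𝔼 n} (h : displacementSign W x = displacementSign W y)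
    {w : 𝔼 n ≃ₗᵢ[ℝ] 𝔼 n} (hw : w ∈ W) (hx : w x = x) : w y = y := by
  refine sub_eq_zero.1 (PiLp.ext fun i => ?_)
  have hi : SignType.sign ((w x - x) i) = SignType.sign ((w y - y) i) :=
    congrFun (congrFun h ⟨w, hw⟩) i
  rw [hx, sub_self, PiLp.zero_apply, sign_zero] at hi
  exact sign_eq_zero_iff.1 hi.symm

theorem SphericalBuilding.determines_of_displacementSign_eq {B : Type*} [MetricSpace B]
    {𝔹 : SphericalBuilding n B} {u v : Sph n}
    (h : displacementSign 𝔹.weyl u = displacementSign 𝔹.weyl v) : 𝔹.Determines u v := by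
  by_cases hfix : ∀ w ∈ 𝔹.weyl, sphAct w v = v
  · exact determines_of_displacement fun w hw _ => hfix w hw
  set K : Set (𝔼 n) := displacementSign 𝔹.weyl ⁻¹' {displacementSign 𝔹.weyl v}
  have hK₀ : ∀ x ∈ K, x ≠ 0 := by
    rintro x hx rfl
    exact hfix fun w hw => Subtype.ext (fixes_of_displacementSign_eq hx hw (map_zero w))
  have hconn : IsPreconnected (toSph '' K) :=
    (convex_displacementSign_preimage _).isPreconnected.image toSph fun x hx =>
      (continuousAt_toSph (hK₀ x hx)).continuousWithinAt
  refine determines_of_isPreconnected hconn ?_ ⟨u, h, toSph_coe u⟩ ⟨v, rfl, toSph_coe v⟩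
  rintro _ ⟨x, hx, rfl⟩ _ ⟨y, hy, rfl⟩ w hw hwx
  rw [sphAct_toSph_eq_iff (hK₀ y hy)]
  exact fixes_of_displacementSign_eq (hx.trans hy.symm) hw ((sphAct_toSph_eq_iff (hK₀ x hx)).1 hwx)

end Strata

section Extension

variable {n : ℕ} {B₁ B₂ : Type*} [MetricSpace B₁] [MetricSpace B₂] {f : B₁ → B₂} {κ : Sph n → B₂}
  {ι : Sph n → B₁} {C : Set B₁}

namespace SphericalBuilding

variable {𝔹₁ : SphericalBuilding n B₁}

theorem IsLift.apply_of_mem_range (hι : 𝔹₁.IsLift f κ ι) (hκ : SphIsometric κ) {x : B₁}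
    (hx : x ∈ range ι) {u : Sph n} (hu : κ u = f x) : ι u = x := by
  obtain ⟨v, rfl⟩ := hx
  rw [hκ.injective (hu.trans (hι.map_eq v))]

theorem IsLift.exists_lift_range_of_finite (hι : 𝔹₁.IsLift f κ ι) (hX : IsCAT1 B₂)
    (hf : LipschitzWith 1 f) (hκ : SphIsometric κ) (hfin : C.Finite)
    (hiso : ∀ x ∈ C, ∀ y ∈ C, dist (f x) (f y) = dist x y) (hC : MapsTo f C (range κ)) :
    ∃ ι', 𝔹₁.IsLift f κ ι' ∧ C ⊆ range ι' := by
  induction C, hfin using Set.Finite.induction_on with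
  | empty => exact ⟨ι, hι, empty_subset _⟩
  | @insert y C _ _ ih =>
    obtain ⟨ι', hι', hCι'⟩ := ih (fun x hx z hz => hiso x (.inr hx) z (.inr hz))
      (hC.mono_left (subset_insert y C))
    obtain ⟨p, hp⟩ := hC (mem_insert y C)
    obtain ⟨ι'', hι'', hy, hkeep⟩ := hι'.exists_lift_through hX hf hκ hp.symm
    refine ⟨ι'', hι'', insert_subset ⟨p, hy⟩ fun x hx => ?_⟩
    obtain ⟨z, rfl⟩ := hCι' hx
    refine ⟨z, hkeep z ?_⟩
    rw [← hiso _ (.inr hx) _ (.inl rfl), hι'.map_eq, ← hp, hκ]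

theorem IsLift.exists_lift_range (hι : 𝔹₁.IsLift f κ ι) (hX : IsCAT1 B₂)
    (hf : LipschitzWith 1 f) (hκ : SphIsometric κ)
    (hiso : ∀ x ∈ C, ∀ y ∈ C, dist (f x) (f y) = dist x y) (hC : MapsTo f C (range κ)) :
    ∃ ι', 𝔹₁.IsLift f κ ι' ∧ C ⊆ range ι' := by
  have := 𝔹₁.finite_weyl
  have hfinite {F : Set B₁} (hF : F.Finite) (hFC : F ⊆ C) :=
    hι.exists_lift_range_of_finite hX hf hκ hF
      (fun x hx y hy => hiso x (hFC hx) y (hFC hy)) (hC.mono_left hFC)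
  have : Nonempty (Sph n) := ⟨toSph 0⟩
  choose! θ hθ using fun x (hx : x ∈ C) => hC hx
  obtain ⟨F, hFC, hF⟩ := exists_subset_bijOn C fun x => displacementSign 𝔹₁.weyl (θ x)
  have hFfin : F.Finite := hF.finite_iff_finite.2 (toFinite _)
  obtain ⟨ι', hι', hFι'⟩ := hfinite hFfin hFC
  refine ⟨ι', hι', fun x hx => ⟨θ x, ?_⟩⟩
  obtain ⟨ι'', hι'', hFι''⟩ := hfinite (hFfin.insert x) (insert_subset hx hFC)
  obtain ⟨y, hy, hyx⟩ := hF.surjOn (mem_image_of_mem _ hx)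
  have hagree : ι' (θ y) = ι'' (θ y) := by
    rw [hι'.apply_of_mem_range hκ (hFι' hy) (hθ y (hFC hy)),
      hι''.apply_of_mem_range hκ (hFι'' (.inr hy)) (hθ y (hFC hy))]
  rw [determines_of_displacementSign_eq hyx ι' hι'.mem_atlas ι'' hι''.mem_atlas hagree]
  exact hι''.apply_of_mem_range hκ (hFι'' (.inl rfl)) (hθ x hx)

theorem IsLift.mapsIsometricallyOnto (hι : 𝔹₁.IsLift f κ ι) (hκ : SphIsometric κ) :
    MapsIsometricallyOnto f (range ι) (range κ) := by
  refine ⟨?_, ?_⟩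
  · rintro _ ⟨u, rfl⟩ _ ⟨v, rfl⟩
    rw [hι.map_eq, hι.map_eq, hκ, 𝔹₁.sphIsometric hι.mem_atlas]
  · rw [← range_comp]
    exact congrArg range (funext hι.map_eq)

end SphericalBuilding

end Extension

theorem proposition3p3_general {n : ℕ} {B₁ B₂ : Type*} [MetricSpace B₁] [MetricSpace B₂]
    (𝔹₁ : SphericalBuilding n B₁) (𝔹₂ : SphericalBuilding n B₂)
    (f : B₁ → B₂) (hf : LipschitzWith 1 f) (hsurj : Function.Surjective f)
    (C₁ : Set B₁) (C₂ : Set B₂) (hC : MapsIsometricallyOnto f C₁ C₂)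
    (A₂ : Set B₂) (hA₂ : 𝔹₂.IsApartment A₂) (hCA : C₂ ⊆ A₂) :
    ∃ A₁ : Set B₁, 𝔹₁.IsApartment A₁ ∧ C₁ ⊆ A₁ ∧ MapsIsometricallyOnto f A₁ A₂ := by
  obtain ⟨κ, hκ, rfl⟩ := hA₂
  obtain ⟨hiso, rfl⟩ := hC
  obtain ⟨G, ι, hι⟩ := 𝔹₁.exists_isLift_comp_sphAct hf hsurj hκ
  have hκG : SphIsometric (κ ∘ sphAct G) := (𝔹₂.sphIsometric hκ).comp_sphAct G
  have hrange : range (κ ∘ sphAct G) = range κ := (sphAct_surjective G).range_comp κ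
  rw [← hrange] at hCA ⊢
  obtain ⟨ι', hι', hCι'⟩ :=
    hι.exists_lift_range 𝔹₂.cat1 hf hκG hiso (mapsTo_iff_image_subset.2 hCA)
  exact ⟨range ι', ⟨ι', hι'.mem_atlas, rfl⟩, hCι', hι'.mapsIsometricallyOnto hκG⟩

theorem proposition3p3 {n : ℕ} {B₁ B₂ : Type*} [MetricSpace B₁] [MetricSpace B₂]
    (𝔹₁ : SphericalBuilding n B₁) (𝔹₂ : SphericalBuilding n B₂)
    (f : B₁ → B₂) (hf : LipschitzWith 1 f) (hsurj : Function.Surjective f)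
    (C₁ : Set B₁) (C₂ : Set B₂) (hconv : IsPiConvex C₁) (hsph : IsSphericalSet C₁)
    (hC : MapsIsometricallyOnto f C₁ C₂)
    (A₂ : Set B₂) (hA₂ : 𝔹₂.IsApartment A₂) (hCA : C₂ ⊆ A₂) :
    ∃ A₁ : Set B₁, 𝔹₁.IsApartment A₁ ∧ C₁ ⊆ A₁ ∧ MapsIsometricallyOnto f A₁ A₂ :=
  proposition3p3_general 𝔹₁ 𝔹₂ f hf hsurj C₁ C₂ hC A₂ hA₂ hCA
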